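/- Let $m\ge 2$ be an integer and $H^i(\,\cdot\,)=H^i(\,\cdot\,,\mathbb Z/m)$ continuous (profinite) cohomology with trivial action. Let $\Omega$ be a nonempty set of central extensions of profinite groups $$\omega:\quad 0\to\mathbb Z/m\to U_\omega\xrightarrow{\lambda_\omega}\bar U_\omega\to 1 ,$$ with classifying elements $\alpha_\omega\in H^2(\bar U_\omega)$, such that for every $\omega\in\Omega$: (I) there are finitely many continuous homomorphisms $\bar U_\omega\to U_\omega$ whose kernels have trivial intersection; (II) $\mathbb Z/m$ embeds in $\bar U_\omega$. For a profinite group $H$ let $T(H)$ (resp. $\bar T(H)$) be the intersection of the kernels of all continuous homomorphisms $H\to U_\omega$ (resp. $H\to\bar U_\omega$), $\omega\in\Omega$. Let $G$ be a profinite group, let $N_1\le N_2$ be closed normal subgroups of $G$ contained in $\bar T(G)$, and let $\pi_i\colon G\to G/N_i$ be the projections. Put $A_G(N_1,N_2)=\mathrm{Ker}(\inf\colon H^2(G/N_2)\to H^2(G/N_1))$. The transgression is an isomorphism from $\mathrm{Ker}(\mathrm{res}\colon H^1(N_2)^G\to H^1(N_1))$ onto $A_G(N_1,N_2)$; let $$\langle\cdot,\cdot\rangle^A\colon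 N_2/N_1N_2^m[G,N_2]\times A_G(N_1,N_2)\to\mathbb Z/m,\qquad \langle\bar\sigma,\mathrm{trg}(\psi)\rangle^A=\psi(\sigma),$$ where $N_2^m[G,N_2]$ denotes the closed subgroup generated by the $m$-th powers in $N_2$ and the commutators $[g,n]$ ($g\in G$, $n\in N_2$). Let $B_G(N_1,N_2)\le A_G(N_1,N_2)$ be the subgroup generated by all elements of $A_G(N_1,N_2)$ of the form $\bar\rho^*(\alpha_\omega)$, where $\omega\in\Omega$ and $\bar\rho\colon G/N_2\to\bar U_\omega$ is a continuous homomorphism for which there is a continuous homomorphism $\rho\colon G\to U_\omega$ with $\lambda_\omega\circ\rho=\bar\rho\circ\pi_2$. Then $N_1N_2^m[G,N_2]\le N_2\cap\pi_1^{-1}[T(G/N_1)]$, and there is a bilinear map $$\langle\cdot,\cdot\rangle^B\colon N_2/(N_2\cap\pi_1^{-1}[T(G/N_1)])\times B_G(N_1,N_2)\to\mathbb Z/m ,$$ continuous in the first variable, which is non-degenerate (the induced homomorphisms from the left group to $\mathrm{Hom}(B_G(N_1,N_2),\mathbb Z/m)$ and from $B_G(N_1,N_2)$ to the group of continuous homomorphisms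 from the left group to $\mathbb Z/m$ are both injective), and which is compatible with $\langle\cdot,\cdot\rangle^A$: if $x\in N_2/N_1N_2^m[G,N_2]$ has image $\bar x$ in $N_2/(N_2\cap\pi_1^{-1}[T(G/N_1)])$ and $b\in B_G(N_1,N_2)$, then $\langle\bar x,b\rangle^B=\langle x,b\rangle^A$. Moreover, if $m=p$ is prime, then $\langle\cdot,\cdot\rangle^B$ is perfect, i.e. both induced homomorphisms are isomorphisms. -/

import Mathlib

universe u v w

namespace KernelGen

/-! ### Continuous cohomology in degrees one and two, with coefficients `ℤ/m` and trivial action -/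

section Cohomology

/-- The group `H¹(G) = Hom_cont(G, ℤ/m)`. -/
abbrev H1 (m : ℕ) (G : Type v) [Group G] [TopologicalSpace G] : Type v :=
  Additive G →ₜ+ ZMod m

/-- The value of a class in `H¹(G)` at an element of `G`. -/
def H1.val {m : ℕ} {G : Type v} [Group G] [TopologicalSpace G] (φ : H1 m G) (g : G) : ZMod m :=
  φ (Additive.ofMul g)

/-- The coboundary `(∂y)(σ, τ) = y(τ) - y(στ) + y(σ)` of an inhomogeneous 1-cochain. -/
def d1 {m : ℕ} {G : Type v} [Group G] (y : G → ZMod m) : G × G → ZMod m :=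
  fun p => y p.2 - y (p.1 * p.2) + y p.1

/-- Continuous inhomogeneous 2-cocycles of `G` with values in (the discrete group) `ℤ/m`. -/
def Z2 (m : ℕ) (G : Type v) [Group G] [TopologicalSpace G] : AddSubgroup (G × G → ZMod m) where
  carrier := {c | Continuous c ∧
    ∀ g h k : G, c (h, k) - c (g * h, k) + c (g, h * k) - c (g, h) = 0}
  zero_mem' := ⟨continuous_const, by simp⟩
  add_mem' := by
    rintro a b ⟨ha, ha'⟩ ⟨hb, hb'⟩
    refine ⟨ha.add hb, fun g h k => ?_⟩
    have h1 := ha' g h k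
    have h2 := hb' g h k
    simp only [Pi.add_apply]
    linear_combination h1 + h2
  neg_mem' := by
    rintro a ⟨ha, ha'⟩
    refine ⟨ha.neg, fun g h k => ?_⟩
    have h1 := ha' g h k
    simp only [Pi.neg_apply]
    linear_combination -h1

/-- 2-coboundaries of continuous 1-cochains. -/
def B2 (m : ℕ) (G : Type v) [Group G] [TopologicalSpace G] : AddSubgroup (Z2 m G) where
  carrier := {c | ∃ y : G → ZMod m, Continuous y ∧ (c : G × G → ZMod m) = d1 y}
  zero_mem' := ⟨0, continuous_const, by ext; simp [d1]⟩
  add_mem' := by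
    rintro a b ⟨y, hy, ha⟩ ⟨z, hz, hb⟩
    refine ⟨y + z, hy.add hz, ?_⟩
    ext p
    simp only [AddSubgroup.coe_add, ha, hb, d1, Pi.add_apply]
    ring
  neg_mem' := by
    rintro a ⟨y, hy, ha⟩
    refine ⟨-y, hy.neg, ?_⟩
    ext p
    simp only [AddSubgroup.coe_neg, ha, d1, Pi.neg_apply]
    ring

/-- The continuous cohomology group `H²(G) = H²(G, ℤ/m)`. -/
abbrev H2 (m : ℕ) (G : Type v) [Group G] [TopologicalSpace G] : Type v :=
  Z2 m G ⧸ B2 m G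

/-- The class in `H²(G)` of a continuous 2-cocycle. -/
def H2.mk {m : ℕ} {G : Type v} [Group G] [TopologicalSpace G] (c : Z2 m G) : H2 m G :=
  QuotientAddGroup.mk c

theorem H2.mk_eq_iff {m : ℕ} {G : Type v} [Group G] [TopologicalSpace G] (c c' : Z2 m G) :
    H2.mk c = H2.mk c' ↔
      ∃ y : G → ZMod m, Continuous y ∧ ∀ p, c'.1 p = c.1 p + d1 y p := by
  unfold H2.mk
  rw [QuotientAddGroup.eq]
  constructor
  · rintro ⟨y, hy, h⟩
    refine ⟨y, hy, fun p => ?_⟩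
    have := congrFun h p
    simp only [AddSubgroup.coe_add, AddSubgroup.coe_neg, Pi.add_apply, Pi.neg_apply] at this
    linear_combination this
  · rintro ⟨y, hy, h⟩
    refine ⟨y, hy, funext fun p => ?_⟩
    have := h p
    simp only [AddSubgroup.coe_add, AddSubgroup.coe_neg, Pi.add_apply, Pi.neg_apply]
    linear_combination this

/-- Pullback of 2-cocycles along a continuous homomorphism. -/
def Z2.map (m : ℕ) {G : Type v} {K : Type w} [Group G] [TopologicalSpace G] [Group K]
    [TopologicalSpace K] (f : G →ₜ* K) : Z2 m K →+ Z2 m G where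
  toFun c := ⟨fun p => c.1 (f p.1, f p.2),
    c.2.1.comp ((f.continuous_toFun.comp continuous_fst).prodMk
      (f.continuous_toFun.comp continuous_snd)), fun g h k => by
    simpa using c.2.2 (f g) (f h) (f k)⟩
  map_zero' := rfl
  map_add' _ _ := rfl

/-- The pullback `f^* : H²(K) → H²(G)` along a continuous homomorphism `f : G → K`. -/
def H2.map (m : ℕ) {G : Type v} {K : Type w} [Group G] [TopologicalSpace G] [Group K]
    [TopologicalSpace K] (f : G →ₜ* K) : H2 m K →+ H2 m G :=
  QuotientAddGroup.map _ _ (Z2.map m f) (by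
    rintro c ⟨y, hy, hc⟩
    refine ⟨fun g => y (f g), hy.comp f.continuous_toFun, ?_⟩
    ext p
    have := congrFun hc (f p.1, f p.2)
    simpa [Z2.map, d1] using this)

variable {m : ℕ} {G : Type v} [Group G] [TopologicalSpace G]

/-- The natural continuous projection `G/N₁ → G/N₂` for `N₁ ≤ N₂`. -/
def quotMap {N₁ N₂ : Subgroup G} [N₁.Normal] [N₂.Normal] (h : N₁ ≤ N₂) :
    (G ⧸ N₁) →ₜ* (G ⧸ N₂) where
  toMonoidHom := QuotientGroup.map N₁ N₂ (MonoidHom.id G) h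
  continuous_toFun := by
    refine (QuotientGroup.isQuotientMap_mk (N := N₁)).continuous_iff.2 ?_
    exact QuotientGroup.continuous_mk (N := N₂)

/-- The inflation map `H²(G/N₂) → H²(G/N₁)` for `N₁ ≤ N₂`. -/
def infl (m : ℕ) {N₁ N₂ : Subgroup G} [N₁.Normal] [N₂.Normal] (h : N₁ ≤ N₂) :
    H2 m (G ⧸ N₂) →+ H2 m (G ⧸ N₁) :=
  H2.map m (quotMap h)

/-- The restriction map `H¹(N₂) → H¹(N₁)` for `N₁ ≤ N₂`. -/
def resH1 (m : ℕ) {N₁ N₂ : Subgroup G} (h : N₁ ≤ N₂) : H1 m N₂ →+ H1 m N₁ where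
  toFun ψ :=
    { toFun := fun n => ψ (Additive.ofMul (Subgroup.inclusion h n.toMul))
      map_zero' := map_zero ψ
      map_add' := fun a b => map_add ψ (Additive.ofMul (Subgroup.inclusion h a.toMul))
        (Additive.ofMul (Subgroup.inclusion h b.toMul))
      continuous_toFun := by
        exact ψ.continuous_toFun.comp (continuous_inclusion h) }
  map_zero' := rfl
  map_add' _ _ := rfl

/-- The invariant part `H¹(N)^G` under conjugation. -/
def invH1 (m : ℕ) (N : Subgroup G) [hN : N.Normal] : AddSubgroup (H1 m N) where
  carrier := {ψ | ∀ (g : G) (n : N), ψ.val ⟨g * n * g⁻¹, hN.conj_mem n n.2 g⟩ = ψ.val n}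
  zero_mem' _ _ := rfl
  add_mem' := by
    intro a b ha hb g n
    have h1 := ha g n
    have h2 := hb g n
    change a.val _ + b.val _ = a.val _ + b.val _
    rw [h1, h2]
  neg_mem' := by
    intro a ha g n
    have h1 := ha g n
    change -a.val _ = -a.val _
    rw [h1]

theorem H1.val_mul (ψ : H1 m G) (a b : G) : ψ.val (a * b) = ψ.val a + ψ.val b :=
  map_add ψ (Additive.ofMul a) (Additive.ofMul b)

theorem H1.val_one (ψ : H1 m G) : ψ.val (1 : G) = 0 := map_zero ψ

theorem H1.val_continuous (ψ : H1 m G) : Continuous ψ.val := ψ.continuous_toFun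

theorem H1.ext' {ψ φ : H1 m G} (h : ∀ g, ψ.val g = φ.val g) : ψ = φ :=
  DFunLike.ext _ _ h

/-- The data describing the transgression of `ψ ∈ H¹(N)^G`: a continuous cochain `y : G → ℤ/m`
extending `ψ`, whose coboundary is the inflation of the 2-cocycle `c` of `G/N`. -/
def IsTrg (N : Subgroup G) [N.Normal] (ψ : H1 m N) (c : Z2 m (G ⧸ N)) : Prop :=
  ∃ y : G → ZMod m, Continuous y ∧ (∀ n : N, y n = ψ.val n) ∧
    ∀ σ τ : G, c.1 ((σ : G ⧸ N), (τ : G ⧸ N)) = d1 y (σ, τ)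

theorem IsTrg.mul_right {N : Subgroup G} [N.Normal] {ψ : H1 m N} {c : Z2 m (G ⧸ N)}
    {y : G → ZMod m} (hy : ∀ n : N, y n = ψ.val n)
    (hc : ∀ σ τ : G, c.1 ((σ : G ⧸ N), (τ : G ⧸ N)) = d1 y (σ, τ)) (g : G) (n : N) :
    y (g * n) = y g + ψ.val n := by
  have h1 := hc g n
  have h2 := hc g 1
  have h3 : ((n : G) : G ⧸ N) = ((1 : G) : G ⧸ N) := by
    rw [QuotientGroup.eq]; simp
  rw [h3, h2] at h1
  have h4 : y 1 = 0 := by simpa [H1.val_one] using hy 1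
  simp only [d1, mul_one, h4, hy n] at h1
  linear_combination h1

theorem IsTrg.unique [IsTopologicalGroup G] {N : Subgroup G} [N.Normal] {ψ : H1 m N}
    {c c' : Z2 m (G ⧸ N)} (h : IsTrg N ψ c) (h' : IsTrg N ψ c') : H2.mk c = H2.mk c' := by
  obtain ⟨y, hyc, hy, hc⟩ := h
  obtain ⟨z, hzc, hz, hc'⟩ := h'
  rw [H2.mk_eq_iff]
  have key : ∀ a b : G, (a : G ⧸ N) = (b : G ⧸ N) → z a - y a = z b - y b := by
    intro a b hab
    rw [QuotientGroup.eq] at hab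
    have e1 := IsTrg.mul_right hy hc a ⟨_, hab⟩
    have e2 := IsTrg.mul_right hz hc' a ⟨_, hab⟩
    simp only [mul_inv_cancel_left] at e1 e2
    rw [e1, e2]; ring
  refine ⟨fun x => z x.out - y x.out, ?_, ?_⟩
  · refine (QuotientGroup.isQuotientMap_mk (N := N)).continuous_iff.2 ?_
    convert hzc.sub hyc using 1
    funext g
    exact key _ _ (by simp)
  · rintro ⟨p, q⟩
    induction p using QuotientGroup.induction_on with | H a => ?_
    induction q using QuotientGroup.induction_on with | H b => ?_
    rw [hc, hc']
    simp only [d1]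
    rw [key (a : G ⧸ N).out a (by simp), key (b : G ⧸ N).out b (by simp),
      key (((a : G ⧸ N) * (b : G ⧸ N)).out) (a * b) (by simp)]
    ring

/-- A continuous extension of an invariant homomorphism to a cochain on a profinite group. -/
theorem exists_cochain [IsTopologicalGroup G] [CompactSpace G] [T2Space G]
    [TotallyDisconnectedSpace G] (N : Subgroup G) [N.Normal] (ψ : H1 m N) :
    ∃ y : G → ZMod m, Continuous y ∧ (∀ n : N, y n = ψ.val n) ∧
      ∀ (g : G) (n : N), y (g * n) = y g + ψ.val n := by
  have hopen : IsOpen {n : N | ψ.val n = 0} :=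
    (isOpen_discrete ({0} : Set (ZMod m))).preimage ψ.val_continuous
  obtain ⟨W, hW, hWe⟩ := isOpen_induced_iff.1 hopen
  have h1W : (1 : G) ∈ W := by
    have : (1 : N) ∈ (Subtype.val ⁻¹' W : Set N) := by
      rw [hWe]; exact ψ.val_one
    exact this
  obtain ⟨V, hV⟩ := ProfiniteGrp.exist_openNormalSubgroup_sub_open_nhds_of_one hW h1W
  let V' : Subgroup G := V.toSubgroup
  have hVn : V'.Normal := V.isNormal'
  have hVo : IsOpen (V' : Set G) := V.isOpen'
  have hVψ : ∀ n : N, (n : G) ∈ V' → ψ.val n = 0 := by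
    intro n hn
    have : n ∈ (Subtype.val ⁻¹' W : Set N) := hV hn
    rw [hWe] at this
    exact this
  -- representatives of the cosets of the open subgroup `N V`
  let M : Subgroup G := N ⊔ V'
  have hMo : IsOpen (M : Set G) := Subgroup.isOpen_mono (le_sup_right : V' ≤ M) hVo
  have hdec : ∀ x : M, ∃ n : N, (n : G)⁻¹ * x ∈ V' := by
    intro x
    obtain ⟨a, ha, b, hb, hab⟩ := Subgroup.mem_sup_of_normal_right.1 x.2
    exact ⟨⟨a, ha⟩, by rw [← hab]; simpa using hb⟩
  choose f hf using hdec
  have huniq : ∀ (x : G) (a b : N), (a : G)⁻¹ * x ∈ V' → (b : G)⁻¹ * x ∈ V' →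
      ψ.val a = ψ.val b := by
    intro x a b ha hb
    have h := V'.mul_mem ha (V'.inv_mem hb)
    have h2 : ψ.val (a⁻¹ * b) = 0 := by
      apply hVψ
      convert h using 1
      simp [mul_assoc]
    have h3 := ψ.val_mul a (a⁻¹ * b)
    rw [mul_inv_cancel_left, h2, add_zero] at h3
    exact h3.symm
  have hrep : ∀ g : G, ((g : G ⧸ M).out)⁻¹ * g ∈ M := by
    intro g
    rw [← QuotientGroup.eq]; simp
  let y0 : G → ZMod m := fun g => ψ.val (f ⟨_, hrep g⟩)
  have hspec : ∀ (g : G) (a : N), (a : G)⁻¹ * ((g : G ⧸ M).out⁻¹ * g) ∈ V' →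
      y0 g = ψ.val a := fun g a ha => huniq _ _ _ (hf _) ha
  have hmul : ∀ (g : G) (n : N), y0 (g * n) = y0 g + ψ.val n := by
    intro g n
    have hc : ((g * n : G) : G ⧸ M) = (g : G ⧸ M) := by
      rw [QuotientGroup.eq]
      simpa using M.inv_mem ((le_sup_left : N ≤ M) n.2)
    have h1 := hf ⟨_, hrep g⟩
    rw [hspec (g * n) (f ⟨_, hrep g⟩ * n), ψ.val_mul]
    rw [hc]
    have := hVn.conj_mem _ h1 (n : G)⁻¹
    convert this using 1
    simp [mul_assoc]
  have hcont : Continuous y0 := by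
    rw [continuous_discrete_rng]
    intro z
    rw [isOpen_iff_mem_nhds]
    intro g hg
    have : (fun v => g * v) '' (V' : Set G) ∈ nhds g := by
      have h := (Homeomorph.mulLeft g).isOpenMap _ hVo
      exact h.mem_nhds ⟨1, V'.one_mem, by simp⟩
    refine Filter.mem_of_superset this ?_
    rintro _ ⟨v, hv, rfl⟩
    have hc : ((g * v : G) : G ⧸ M) = (g : G ⧸ M) := by
      rw [QuotientGroup.eq]
      simpa using M.inv_mem ((le_sup_right : V' ≤ M) hv)
    have h1 := hf ⟨_, hrep g⟩
    change y0 (g * v) = z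
    rw [hspec (g * v) (f ⟨_, hrep g⟩)]
    · exact hg
    · rw [hc]
      have := V'.mul_mem h1 hv
      convert this using 1
      simp [mul_assoc]
  have hone : ∀ n : N, y0 n = y0 1 + ψ.val n := by
    intro n
    have := hmul 1 n
    rwa [one_mul] at this
  refine ⟨fun g => y0 g - y0 1, hcont.sub continuous_const, fun n => ?_, fun g n => ?_⟩
  · change y0 n - y0 1 = _
    rw [hone]; ring
  · change y0 (g * n) - y0 1 = _
    rw [hmul]; ring

theorem d1_mem_Z2 [IsTopologicalGroup G] {y : G → ZMod m} (hy : Continuous y) :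
    d1 y ∈ Z2 m G := by
  refine ⟨?_, fun g h k => ?_⟩
  · exact ((hy.comp continuous_snd).sub (hy.comp continuous_mul)).add (hy.comp continuous_fst)
  · simp only [d1, mul_assoc]; ring

theorem exists_isTrg [IsTopologicalGroup G] [CompactSpace G] [T2Space G]
    [TotallyDisconnectedSpace G] (N : Subgroup G) [hN : N.Normal] (ψ : H1 m N)
    (hψ : ψ ∈ invH1 m N) : ∃ c : Z2 m (G ⧸ N), IsTrg N ψ c := by
  obtain ⟨y, hyc, hy, hmul⟩ := exists_cochain N ψ
  have key : ∀ a b a' b' : G, (a : G ⧸ N) = a' → (b : G ⧸ N) = b' →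
      d1 y (a, b) = d1 y (a', b') := by
    intro a b a' b' ha hb
    rw [QuotientGroup.eq] at ha hb
    obtain ⟨s, hs⟩ : ∃ s : N, a' = a * s := ⟨⟨_, ha⟩, by simp⟩
    obtain ⟨t, ht⟩ : ∃ t : N, b' = b * t := ⟨⟨_, hb⟩, by simp⟩
    subst hs ht
    have e := hψ b⁻¹ s
    have e2 : a * s * (b * t) = (a * b) *
        ((⟨b⁻¹ * s * b⁻¹⁻¹, hN.conj_mem s s.2 b⁻¹⟩ * t : N) : G) := by
      simp [mul_assoc]
    simp only [d1]
    rw [e2, hmul, hmul, hmul, H1.val_mul, e]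
    ring
  have hpull : ∀ σ τ : G,
      d1 y (((σ : G ⧸ N)).out, ((τ : G ⧸ N)).out) = d1 y (σ, τ) :=
    fun σ τ => key _ _ _ _ (by simp) (by simp)
  refine ⟨⟨fun p => d1 y (p.1.out, p.2.out), ?_, ?_⟩, y, hyc, hy, hpull⟩
  · have hq : IsOpenQuotientMap (QuotientGroup.mk : G → G ⧸ N) :=
      QuotientGroup.isOpenQuotientMap_mk
    refine (hq.prodMap hq).isQuotientMap.continuous_iff.2 ?_
    convert (d1_mem_Z2 hyc).1 using 1
    funext p
    exact hpull p.1 p.2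
  · intro a b c
    induction a using QuotientGroup.induction_on with | H a => ?_
    induction b using QuotientGroup.induction_on with | H b => ?_
    induction c using QuotientGroup.induction_on with | H c => ?_
    simp only [← QuotientGroup.mk_mul]
    rw [hpull, hpull, hpull, hpull]
    exact (d1_mem_Z2 hyc).2 a b c

/-- The transgression `trg : H¹(N)^G → H²(G/N)` for a profinite group `G`. -/
noncomputable def trg (m : ℕ) [IsTopologicalGroup G] [CompactSpace G] [T2Space G]
    [TotallyDisconnectedSpace G] (N : Subgroup G) [N.Normal] :
    invH1 m N →+ H2 m (G ⧸ N) :=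
  AddMonoidHom.mk' (fun ψ => H2.mk (exists_isTrg N ψ.1 ψ.2).choose) (by
    intro a b
    have ha := (exists_isTrg N a.1 a.2).choose_spec
    have hb := (exists_isTrg N b.1 b.2).choose_spec
    have hab := (exists_isTrg N (a + b).1 (a + b).2).choose_spec
    refine (IsTrg.unique hab ?_).trans
      (rfl : H2.mk ((exists_isTrg N a.1 a.2).choose + (exists_isTrg N b.1 b.2).choose) = _)
    obtain ⟨y, hyc, hy, hc⟩ := ha
    obtain ⟨z, hzc, hz, hc'⟩ := hb
    refine ⟨y + z, hyc.add hzc, fun n => ?_, fun σ τ => ?_⟩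
    · simp only [Pi.add_apply, hy, hz]; rfl
    · simp only [AddSubgroup.coe_add, Pi.add_apply, hc, hc', d1]; ring)

theorem trg_eq [IsTopologicalGroup G] [CompactSpace G] [T2Space G]
    [TotallyDisconnectedSpace G] (N : Subgroup G) [N.Normal] (ψ : invH1 m N)
    {c : Z2 m (G ⧸ N)} (h : IsTrg N ψ.1 c) : trg m N ψ = H2.mk c :=
  IsTrg.unique (exists_isTrg N ψ.1 ψ.2).choose_spec h

theorem trg_spec [IsTopologicalGroup G] [CompactSpace G] [T2Space G]
    [TotallyDisconnectedSpace G] (N : Subgroup G) [N.Normal] (ψ : invH1 m N) :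
    ∃ c, IsTrg N ψ.1 c ∧ trg m N ψ = H2.mk c :=
  ⟨_, (exists_isTrg N ψ.1 ψ.2).choose_spec, rfl⟩

/-- `A_G(N₁, N₂) = Ker(inf : H²(G/N₂) → H²(G/N₁))`. -/
def AG (m : ℕ) {N₁ N₂ : Subgroup G} [N₁.Normal] [N₂.Normal] (h : N₁ ≤ N₂) :
    AddSubgroup (H2 m (G ⧸ N₂)) :=
  (infl m h).ker

/-- `Ker(res : H¹(N₂)^G → H¹(N₁))`. -/
def resKer (m : ℕ) {N₁ N₂ : Subgroup G} [N₂.Normal] (h : N₁ ≤ N₂) :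
    AddSubgroup (invH1 m N₂) :=
  ((resH1 m h).comp (invH1 m N₂).subtype).ker

theorem mem_resKer {N₁ N₂ : Subgroup G} [N₂.Normal] (h : N₁ ≤ N₂) (ψ : invH1 m N₂) :
    ψ ∈ resKer m h ↔ ∀ (g : G) (hg : g ∈ N₁), ψ.1.val ⟨g, h hg⟩ = 0 := by
  constructor
  · intro hψ g hg
    exact DFunLike.congr_fun (hψ : (resH1 m h) ψ.1 = 0) (Additive.ofMul (⟨g, hg⟩ : N₁))
  · intro hψ
    exact H1.ext' (ψ := resH1 m h ψ.1) (φ := 0) fun g => hψ g.1 g.2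

end Cohomology

/-! ### The pairing of `A_G(N₁, N₂)` obtained from the transgression -/

section APairing

variable {m : ℕ} {G : Type v} [Group G] [TopologicalSpace G] [IsTopologicalGroup G]

/-- A bilinear map `A × B → ℤ/m`, for a profinite abelian group `A` (written multiplicatively) and
a discrete abelian group `B`, which is continuous in the first variable. It is
given by the homomorphism `B → Hom_cont(A, ℤ/m)` which it induces. -/
abbrev Pairing (m : ℕ) (A : Type v) (B : Type w) [Group A] [TopologicalSpace A]
    [AddCommGroup B] : Type (max v w) :=
  B →+ (Additive A →ₜ+ ZMod m)

/-- The value `⟨a, b⟩` of a pairing. -/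
def Pairing.val {A : Type v} {B : Type w} [Group A] [TopologicalSpace A] [AddCommGroup B]
    (P : Pairing m A B) (a : A) (b : B) : ZMod m :=
  P b (Additive.ofMul a)

/-- The homomorphism `A → Hom(B, ℤ/m)` induced by a pairing. -/
def Pairing.left {A : Type v} {B : Type w} [Group A] [TopologicalSpace A] [AddCommGroup B]
    (P : Pairing m A B) : Additive A →+ (B →+ ZMod m) where
  toFun a :=
    { toFun := fun b => P.val a.toMul b
      map_zero' := by simp [Pairing.val]
      map_add' := fun b c => by simp only [Pairing.val, map_add]; rfl }
  map_zero' := by ext b; exact map_zero (P b)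
  map_add' a a' := by ext b; exact map_add (P b) a a'

/-- The homomorphism `B → Hom_cont(A, ℤ/m)` induced by a pairing. -/
def Pairing.right {A : Type v} {B : Type w} [Group A] [TopologicalSpace A] [AddCommGroup B]
    (P : Pairing m A B) : B →+ (Additive A →ₜ+ ZMod m) := P

/-- Both induced homomorphisms are injective. -/
def Pairing.Nondegenerate {A : Type v} {B : Type w} [Group A] [TopologicalSpace A]
    [AddCommGroup B] (P : Pairing m A B) : Prop :=
  Function.Injective P.left ∧ Function.Injective P.right

/-- Both induced homomorphisms are isomorphisms. -/
def Pairing.Perfect {A : Type v} {B : Type w} [Group A] [TopologicalSpace A]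
    [AddCommGroup B] (P : Pairing m A B) : Prop :=
  Function.Bijective P.left ∧ Function.Bijective P.right

/-- The (closed) subgroup `N₁ N₂^m [G, N₂]` of `G`. -/
def powComm (m : ℕ) (N₁ N₂ : Subgroup G) : Subgroup G :=
  (N₁ ⊔ (Subgroup.closure ((fun x : G => x ^ m) '' (N₂ : Set G)) ⊔ ⁅(⊤ : Subgroup G), N₂⁆)
    ).topologicalClosure

instance powComm_normal (m : ℕ) (N₁ N₂ : Subgroup G) [hN₁ : N₁.Normal] [hN₂ : N₂.Normal] :
    (powComm m N₁ N₂).Normal := by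
  have : (Subgroup.closure ((fun x : G => x ^ m) '' (N₂ : Set G))).Normal := by
    have hset : (fun x : G => x ^ m) '' (N₂ : Set G) =
        Group.conjugatesOfSet ((fun x : G => x ^ m) '' (N₂ : Set G)) := by
      refine Set.Subset.antisymm Group.subset_conjugatesOfSet ?_
      intro x hx
      obtain ⟨y, ⟨n, hn, rfl⟩, hy⟩ := Group.mem_conjugatesOfSet_iff.1 hx
      obtain ⟨g, rfl⟩ := isConj_iff.1 hy
      exact ⟨g * n * g⁻¹, hN₂.conj_mem n hn g, by simp [conj_pow]⟩
    rw [hset]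
    exact Subgroup.normalClosure_normal
  exact Subgroup.is_normal_topologicalClosure _

/-- Every element of `Ker(res : H¹(N₂)^G → H¹(N₁))` vanishes on `N₁ N₂^m [G, N₂]`. -/
theorem resKer_vanish {N₁ N₂ : Subgroup G} [hN : N₂.Normal]
    (h : N₁ ≤ N₂) (hcl : IsClosed (N₂ : Set G)) (ψ : resKer m h) (n : N₂)
    (hn : (n : G) ∈ powComm m N₁ N₂) : ψ.1.1.val n = 0 := by
  let K : Subgroup G := (AddMonoidHom.toMultiplicativeRight
    (ψ.1.1 : Additive N₂ →+ ZMod m)).ker.map N₂.subtype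
  have hK : ∀ x : N₂, ψ.1.1.val x = 0 → (x : G) ∈ K := by
    intro x hx
    exact ⟨x, hx, rfl⟩
  have hK' : ∀ x : N₂, (x : G) ∈ K → ψ.1.1.val x = 0 := by
    rintro x ⟨y, hy, hyx⟩
    obtain rfl : y = x := Subtype.ext hyx
    exact hy
  have hcK : IsClosed (K : Set G) := by
    have h0 : IsClosed {x : N₂ | ψ.1.1.val x = 0} :=
      isClosed_eq ψ.1.1.val_continuous continuous_const
    have h1 := hcl.isClosedEmbedding_subtypeVal.isClosedMap _ h0
    convert h1 using 1
    ext g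
    constructor
    · rintro ⟨x, hx, rfl⟩
      exact ⟨x, hx, rfl⟩
    · rintro ⟨x, hx, rfl⟩
      exact ⟨x, hx, rfl⟩
  refine hK' n ((Subgroup.topologicalClosure_minimal _ ?_ hcK) hn)
  refine sup_le ?_ (sup_le ?_ ?_)
  · intro g hg
    exact hK ⟨g, h hg⟩ ((mem_resKer h ψ.1).1 ψ.2 g hg)
  · rw [Subgroup.closure_le]
    rintro _ ⟨g, hg, rfl⟩
    refine hK (⟨g, hg⟩ ^ m) ?_
    have : ∀ k : ℕ, ψ.1.1.val ((⟨g, hg⟩ : N₂) ^ k) = k * ψ.1.1.val ⟨g, hg⟩ := by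
      intro k
      induction k with
      | zero => simp [H1.val_one]
      | succ k ih => rw [pow_succ, H1.val_mul, ih]; push_cast; ring
    rw [this]; simp
  · rw [Subgroup.commutator_le]
    intro g _ x hx
    have e := ψ.1.2 g ⟨x, hx⟩
    have e2 := ψ.1.1.val_mul ⟨g * x * g⁻¹, hN.conj_mem x hx g⟩ ⟨x, hx⟩⁻¹
    have e3 := ψ.1.1.val_mul ⟨x, hx⟩ ⟨x, hx⟩⁻¹
    rw [mul_inv_cancel, H1.val_one] at e3
    refine hK (⟨g * x * g⁻¹, hN.conj_mem x hx g⟩ * ⟨x, hx⟩⁻¹) ?_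
    rw [e2, e, ← e3]

/-- The substitution pairing
`N₂ / N₁ N₂^m [G, N₂] × Ker(H¹(N₂)^G → H¹(N₁)) → ℤ/m`, `(σ, ψ) ↦ ψ(σ)`. -/
def substPairing (m : ℕ) {N₁ N₂ : Subgroup G} [N₁.Normal] [N₂.Normal]
    (h : N₁ ≤ N₂) (hcl : IsClosed (N₂ : Set G)) :
    Pairing m (N₂ ⧸ (powComm m N₁ N₂).subgroupOf N₂) (resKer m h) where
  toFun ψ :=
    { toFun := fun x => (QuotientGroup.lift ((powComm m N₁ N₂).subgroupOf N₂)
        (AddMonoidHom.toMultiplicativeRight (ψ.1.1 : Additive N₂ →+ ZMod m))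
        (fun n hn => resKer_vanish h hcl ψ n hn) x.toMul).toAdd
      map_zero' := by simp
      map_add' := fun a b => by simp
      continuous_toFun := by
        refine (QuotientGroup.isQuotientMap_mk
          (N := (powComm m N₁ N₂).subgroupOf N₂)).continuous_iff.2 ?_
        exact ψ.1.1.continuous_toFun }
  map_zero' := by
    refine DFunLike.ext _ _ fun x => ?_
    obtain ⟨n, hn⟩ := QuotientGroup.mk_surjective x.toMul
    obtain rfl : x = Additive.ofMul (QuotientGroup.mk n) := by rw [hn]; rfl
    rfl
  map_add' a b := by
    refine DFunLike.ext _ _ fun x => ?_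
    obtain ⟨n, hn⟩ := QuotientGroup.mk_surjective x.toMul
    obtain rfl : x = Additive.ofMul (QuotientGroup.mk n) := by rw [hn]; rfl
    rfl

theorem substPairing_val {N₁ N₂ : Subgroup G} [N₁.Normal] [N₂.Normal]
    (h : N₁ ≤ N₂) (hcl : IsClosed (N₂ : Set G)) (σ : N₂) (ψ : resKer m h) :
    (substPairing m h hcl).val (QuotientGroup.mk σ) ψ = ψ.1.1.val σ := rfl

variable [CompactSpace G] [T2Space G] [TotallyDisconnectedSpace G]

theorem trg_mem_AG {N₁ N₂ : Subgroup G} [N₁.Normal] [N₂.Normal] (h : N₁ ≤ N₂)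
    (ψ : resKer m h) : trg m N₂ ψ.1 ∈ AG m h := by
  obtain ⟨c, ⟨y, hyc, hy, hc⟩, e⟩ := trg_spec N₂ ψ.1
  rw [e]
  have key : ∀ a b : G, (a : G ⧸ N₁) = b → y a = y b := by
    intro a b hab
    rw [QuotientGroup.eq] at hab
    have e1 := IsTrg.mul_right hy hc a ⟨_, h hab⟩
    rw [(mem_resKer h ψ.1).1 ψ.2 _ hab] at e1
    simpa using e1.symm
  have hz : H2.mk (0 : Z2 m (G ⧸ N₁)) = H2.mk (Z2.map m (quotMap h) c) := by
    rw [H2.mk_eq_iff]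
    refine ⟨fun x => y x.out, ?_, ?_⟩
    · refine (QuotientGroup.isQuotientMap_mk (N := N₁)).continuous_iff.2 ?_
      convert hyc using 1
      funext g
      exact key _ _ (by simp)
    · rintro ⟨p, q⟩
      induction p using QuotientGroup.induction_on with | H a => ?_
      induction q using QuotientGroup.induction_on with | H b => ?_
      have := hc a b
      simp only [d1] at this ⊢
      rw [key (a : G ⧸ N₁).out a (by simp), key (b : G ⧸ N₁).out b (by simp),
        key (((a : G ⧸ N₁) * (b : G ⧸ N₁)).out) (a * b) (by simp), ← this]
      exact (zero_add _).symm
  exact hz.symm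

/-- The transgression as a map `Ker(H¹(N₂)^G → H¹(N₁)) → A_G(N₁, N₂)`. -/
noncomputable def trgA (m : ℕ) {N₁ N₂ : Subgroup G} [N₁.Normal] [N₂.Normal] (h : N₁ ≤ N₂) :
    resKer m h →+ AG m h :=
  ((trg m N₂).comp (resKer m h).subtype).codRestrict (AG m h) (trg_mem_AG h)

theorem trgA_bijective {N₁ N₂ : Subgroup G} [N₁.Normal] [N₂.Normal] (h : N₁ ≤ N₂)
    (hH1 : ∀ (φ : H1 m G) (g : G), g ∈ N₂ → φ.val g = 0) :
    Function.Bijective (trgA m h) := by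
  constructor
  · rw [injective_iff_map_eq_zero]
    intro ψ hψ
    obtain ⟨c, ⟨y, hyc, hy, hc⟩, e⟩ := trg_spec N₂ ψ.1
    have h0 : H2.mk (0 : Z2 m (G ⧸ N₂)) = H2.mk c := by
      rw [← e]; exact (congrArg Subtype.val hψ).symm
    obtain ⟨z, hzc, hz⟩ := (H2.mk_eq_iff _ _).1 h0
    have hadd : ∀ a b : G, y (a * b) - z ((a * b : G) : G ⧸ N₂) =
        (y a - z (a : G ⧸ N₂)) + (y b - z (b : G ⧸ N₂)) := by
      intro a b
      have h1 := hz ((a : G ⧸ N₂), (b : G ⧸ N₂))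
      rw [hc a b] at h1
      simp only [d1, ZeroMemClass.coe_zero, Pi.zero_apply, zero_add, ← QuotientGroup.mk_mul] at h1
      linear_combination -h1
    let φ : H1 m G :=
      { toAddMonoidHom := AddMonoidHom.mk'
          (fun g : Additive G => y g.toMul - z (g.toMul : G ⧸ N₂)) (fun a b => hadd _ _)
        continuous_toFun := hyc.sub (hzc.comp QuotientGroup.continuous_mk) }
    have hφ : ∀ g : G, φ.val g = y g - z (g : G ⧸ N₂) := fun g => rfl
    have hz1 : z 1 = 0 := by
      have h1 := hH1 φ 1 N₂.one_mem
      have h2 : y 1 = 0 := by simpa [H1.val_one] using hy 1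
      rw [hφ, h2] at h1
      simpa using h1
    apply Subtype.ext
    apply Subtype.ext
    refine H1.ext' fun n => ?_
    have h1 := hH1 φ n n.2
    have h3 : ((n : G) : G ⧸ N₂) = 1 := (QuotientGroup.eq_one_iff _).2 n.2
    rw [hφ, hy, h3, hz1, sub_zero] at h1
    exact h1
  · rintro ⟨a, ha⟩
    obtain ⟨c, rfl⟩ := QuotientAddGroup.mk_surjective a
    have h0 : H2.mk (0 : Z2 m (G ⧸ N₁)) = H2.mk (Z2.map m (quotMap h) c) := Eq.symm ha
    obtain ⟨z, hzc, hz⟩ := (H2.mk_eq_iff _ _).1 h0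
    -- normalise the cochain and the cocycle
    let k : ZMod m := z 1
    have hz' : ∀ a b : G, c.1 ((a : G ⧸ N₂), (b : G ⧸ N₂)) =
        z (b : G ⧸ N₁) - z ((a * b : G) : G ⧸ N₁) + z (a : G ⧸ N₁) := by
      intro a b
      have := hz ((a : G ⧸ N₁), (b : G ⧸ N₁))
      exact this.trans (zero_add _)
    let y : G → ZMod m := fun g => z (g : G ⧸ N₁) - k
    have hyc : Continuous y := (hzc.comp QuotientGroup.continuous_mk).sub continuous_const
    let c' : Z2 m (G ⧸ N₂) := c - ⟨d1 (fun _ => k), d1_mem_Z2 continuous_const⟩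
    have hc' : ∀ a b : G, c'.1 ((a : G ⧸ N₂), (b : G ⧸ N₂)) = d1 y (a, b) := by
      intro a b
      change c.1 ((a : G ⧸ N₂), (b : G ⧸ N₂)) -
        d1 (fun _ : G ⧸ N₂ => k) ((a : G ⧸ N₂), (b : G ⧸ N₂)) = _
      rw [hz']
      simp only [d1, y]
      ring
    have hy1 : y 1 = 0 := by simp [y, k]
    have hmul : ∀ (g : G) (n : N₂), y (g * n) = y g + y n := by
      intro g n
      have h1 := hc' g n
      have h3 : ((n : G) : G ⧸ N₂) = ((1 : G) : G ⧸ N₂) := by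
        rw [QuotientGroup.eq]; simp
      rw [h3, hc' g 1] at h1
      simp only [d1, mul_one, hy1] at h1
      linear_combination h1
    let ψ : H1 m N₂ :=
      { toAddMonoidHom := AddMonoidHom.mk' (fun n : Additive N₂ => y (n.toMul : N₂))
          (fun a b => hmul _ _)
        continuous_toFun := hyc.comp continuous_subtype_val }
    have hψ : ∀ n : N₂, ψ.val n = y n := fun n => rfl
    have hinv : ψ ∈ invH1 m N₂ := by
      intro g n
      rw [hψ, hψ]
      have h1 := hc' n g
      have h3 : ((n : G) : G ⧸ N₂) = ((1 : G) : G ⧸ N₂) := by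
        rw [QuotientGroup.eq]; simp
      rw [h3, hc' 1 g] at h1
      simp only [d1, one_mul, hy1] at h1
      have h2 := hmul (g * n * g⁻¹ * g)
        ⟨1, N₂.one_mem⟩
      have hnm : (g * n * g⁻¹) ∈ N₂ := (inferInstance : N₂.Normal).conj_mem n n.2 g
      have h4 := hc' (g * n * g⁻¹) g
      have h5 : ((g * n * g⁻¹ : G) : G ⧸ N₂) = ((1 : G) : G ⧸ N₂) := by
        rw [QuotientGroup.eq]; simpa using N₂.inv_mem hnm
      rw [h5, hc' 1 g] at h4
      simp only [d1, one_mul, hy1, inv_mul_cancel_right] at h4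
      have h6 := hmul g n
      simp only
      linear_combination -h4 + h6
    have hmem : (⟨ψ, hinv⟩ : invH1 m N₂) ∈ resKer m h := by
      rw [mem_resKer]
      intro g hg
      change z (g : G ⧸ N₁) - z 1 = 0
      rw [(QuotientGroup.eq_one_iff g).2 hg, sub_self]
    refine ⟨⟨⟨ψ, hinv⟩, hmem⟩, Subtype.ext ?_⟩
    change trg m N₂ ⟨ψ, hinv⟩ = H2.mk c
    rw [trg_eq N₂ ⟨ψ, hinv⟩ (c := c') ⟨y, hyc, fun n => rfl, hc'⟩, H2.mk_eq_iff]
    refine ⟨fun _ => k, continuous_const, fun p => ?_⟩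
    change _ = c.1 p - d1 (fun _ : G ⧸ N₂ => k) p + d1 (fun _ : G ⧸ N₂ => k) p
    ring

/-- The transgression as an isomorphism `Ker(H¹(N₂)^G → H¹(N₁)) ≃ A_G(N₁, N₂)`, available when all
continuous homomorphisms `G → ℤ/m` are trivial on `N₂`. -/
noncomputable def trgEquiv {N₁ N₂ : Subgroup G} [N₁.Normal] [N₂.Normal] (h : N₁ ≤ N₂)
    (hH1 : ∀ (φ : H1 m G) (g : G), g ∈ N₂ → φ.val g = 0) : resKer m h ≃+ AG m h :=
  AddEquiv.ofBijective (trgA m h) (trgA_bijective h hH1)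

end APairing

/-! ### Central extensions, the subgroups `T`, `T̄`, liftable pullbacks and `B_G(N₁, N₂)` -/

/-- A central extension `0 → ℤ/m → U → Ū → 1` of profinite groups. -/
structure CentralExtension (m : ℕ) where
  U : ProfiniteGrp.{u}
  Ubar : ProfiniteGrp.{u}
  ι : Multiplicative (ZMod m) →* U
  lam : U →ₜ* Ubar
  ι_injective : Function.Injective ι
  lam_surjective : Function.Surjective lam
  exact : ∀ x : U, lam x = 1 ↔ x ∈ ι.range
  central : ∀ z x, ι z * x = x * ι z

namespace CentralExtension

variable {m : ℕ} (ω : CentralExtension.{u} m)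

/-- There are finitely many continuous homomorphisms `Ū → U` whose kernels intersect trivially. -/
def CondI : Prop :=
  ∃ (n : ℕ) (γ : Fin n → (ω.Ubar →ₜ* ω.U)), ∀ x, (∀ i, γ i x = 1) → x = 1

/-- `ℤ/m` embeds in `Ū`. -/
def CondII : Prop :=
  ∃ j : Multiplicative (ZMod m) →* ω.Ubar, Function.Injective j

/-- `c` is the factor set of a continuous section `s` of `U → Ū`, that is,
`s(x) s(y) = c(x, y) s(xy)`. -/
def IsFactorSet (c : Z2 m ω.Ubar) : Prop :=
  ∃ s : ω.Ubar → ω.U, Continuous s ∧ (∀ x, ω.lam (s x) = x) ∧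
    ∀ x y, s x * s y = ω.ι (Multiplicative.ofAdd (c.1 (x, y))) * s (x * y)

theorem isClosedEmbedding_ι [NeZero m] : Topology.IsClosedEmbedding ω.ι :=
  Continuous.isClosedEmbedding continuous_of_discreteTopology ω.ι_injective

theorem ι_mul (a b : ZMod m) : ω.ι (Multiplicative.ofAdd a) * ω.ι (Multiplicative.ofAdd b) =
    ω.ι (Multiplicative.ofAdd (a + b)) :=
  (map_mul ω.ι _ _).symm

theorem exists_section [NeZero m] :
    ∃ s : ω.Ubar → ω.U, Continuous s ∧ ∀ x, ω.lam (s x) = x := by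
  let N : Subgroup ω.U := (ω.lam : ω.U →* ω.Ubar).ker
  have hker : ∀ n : N, ∃ z : ZMod m, ω.ι (Multiplicative.ofAdd z) = n := by
    intro n
    obtain ⟨z, hz⟩ := (ω.exact n).1 n.2
    exact ⟨z.toAdd, hz⟩
  choose f hf using hker
  have hfinj : Function.Injective f := by
    intro a b hab
    apply Subtype.ext
    rw [← hf a, ← hf b, hab]
  have : Finite N := Finite.of_injective f hfinj
  let ψ : H1 m N :=
    { toAddMonoidHom := AddMonoidHom.mk' (fun n : Additive N => f n.toMul) (by
        intro a b
        apply Multiplicative.ofAdd.injective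
        apply ω.ι_injective
        rw [hf, ofAdd_add, map_mul, hf, hf]
        rfl)
      continuous_toFun := continuous_of_discreteTopology (α := N) }
  have hψ : ∀ n : N, ω.ι (Multiplicative.ofAdd (ψ.val n)) = n := hf
  obtain ⟨y, hyc, hy, hmul⟩ := exists_cochain N ψ
  choose r hr using ω.lam_surjective
  let t : ω.U → ω.U := fun u => u * (ω.ι (Multiplicative.ofAdd (y u)))⁻¹
  have htc : Continuous t := continuous_id.mul
    ((continuous_of_discreteTopology (f := fun z : ZMod m =>
      (ω.ι (Multiplicative.ofAdd z))⁻¹)).comp hyc)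
  have ht : ∀ a b, ω.lam a = ω.lam b → t a = t b := by
    intro a b hab
    have hn : a⁻¹ * b ∈ N := by
      change ω.lam (a⁻¹ * b) = 1
      rw [map_mul, map_inv, hab, inv_mul_cancel]
    have h1 := hmul a ⟨_, hn⟩
    have h2 := hψ ⟨_, hn⟩
    simp only [mul_inv_cancel_left] at h1
    simp only [t]
    rw [h1, ofAdd_add, map_mul, h2, mul_inv_rev, mul_inv_rev]
    simp [mul_assoc]
  refine ⟨fun x => t (r x), ?_, fun x => ?_⟩
  · have hq : Topology.IsQuotientMap ω.lam :=
      (ω.lam.continuous_toFun.isClosedMap).isQuotientMap ω.lam.continuous_toFun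
        ω.lam_surjective
    refine hq.continuous_iff.2 ?_
    convert htc using 1
    funext u
    exact ht _ _ (hr _)
  · simp only [t, map_mul, map_inv, hr]
    rw [(ω.exact _).2 ⟨_, rfl⟩]
    simp

theorem exists_isFactorSet [NeZero m] : ∃ c, ω.IsFactorSet c := by
  obtain ⟨s, hsc, hs⟩ := ω.exists_section
  have h : ∀ p : ω.Ubar × ω.Ubar, ∃ z : ZMod m,
      ω.ι (Multiplicative.ofAdd z) = s p.1 * s p.2 * (s (p.1 * p.2))⁻¹ := by
    intro p
    obtain ⟨z, hz⟩ := (ω.exact (s p.1 * s p.2 * (s (p.1 * p.2))⁻¹)).1 (by simp [hs])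
    exact ⟨z.toAdd, hz⟩
  choose c hc using h
  have hfac : ∀ x y, s x * s y = ω.ι (Multiplicative.ofAdd (c (x, y))) * s (x * y) := by
    intro x y; rw [hc]; simp
  refine ⟨⟨c, ?_, ?_⟩, s, hsc, hs, hfac⟩
  · have h1 : Continuous (fun p => ω.ι (Multiplicative.ofAdd (c p))) := by
      simp only [hc]
      fun_prop
    exact ω.isClosedEmbedding_ι.isEmbedding.continuous_iff.2 h1
  · intro g h k
    have e : ω.ι (Multiplicative.ofAdd (c (g, h))) * ω.ι (Multiplicative.ofAdd (c (g * h, k))) =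
        ω.ι (Multiplicative.ofAdd (c (h, k))) * ω.ι (Multiplicative.ofAdd (c (g, h * k))) := by
      apply mul_right_cancel (b := s (g * h * k))
      rw [mul_assoc, ← hfac, ← mul_assoc, ← hfac, mul_assoc, hfac h k, ← mul_assoc,
        ← ω.central, mul_assoc, hfac, mul_assoc, mul_assoc]
    rw [ω.ι_mul, ω.ι_mul] at e
    have e' := Multiplicative.ofAdd.injective (ω.ι_injective e)
    linear_combination -e'

/-- The classifying element `α_ω ∈ H²(Ū)` of the central extension, i.e. the class of the factor
set of a continuous section. -/
noncomputable def cls [NeZero m] : H2 m ω.Ubar := H2.mk ω.exists_isFactorSet.choose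

/-- The classifying element does not depend on the section. -/
theorem cls_eq [NeZero m] {c : Z2 m ω.Ubar} (hc : ω.IsFactorSet c) : ω.cls = H2.mk c := by
  obtain ⟨s, hsc, hs, hf⟩ := ω.exists_isFactorSet.choose_spec
  obtain ⟨t, htc, ht, hg⟩ := hc
  unfold cls
  rw [H2.mk_eq_iff]
  have h : ∀ x, ∃ z : ZMod m, ω.ι (Multiplicative.ofAdd z) = t x * (s x)⁻¹ := by
    intro x
    obtain ⟨z, hz⟩ := (ω.exact (t x * (s x)⁻¹)).1 (by simp [hs, ht])
    exact ⟨z.toAdd, hz⟩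
  choose e he using h
  have he' : ∀ x, t x = ω.ι (Multiplicative.ofAdd (e x)) * s x := by
    intro x; rw [he]; simp
  refine ⟨e, ?_, ?_⟩
  · have h1 : Continuous (fun p => ω.ι (Multiplicative.ofAdd (e p))) := by
      simp only [he]
      fun_prop
    exact ω.isClosedEmbedding_ι.isEmbedding.continuous_iff.2 h1
  · rintro ⟨x, y⟩
    have e1 := hg x y
    rw [he' x, he' y, he' (x * y)] at e1
    have e2 : ω.ι (Multiplicative.ofAdd (e x)) * ω.ι (Multiplicative.ofAdd (e y)) *
          ω.ι (Multiplicative.ofAdd (ω.exists_isFactorSet.choose.1 (x, y))) =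
        ω.ι (Multiplicative.ofAdd (c.1 (x, y))) * ω.ι (Multiplicative.ofAdd (e (x * y))) := by
      apply mul_right_cancel (b := s (x * y))
      rw [mul_assoc (ω.ι (Multiplicative.ofAdd (c.1 (x, y)))), ← e1, mul_assoc _ _ (s (x * y)),
        ← hf]
      rw [mul_assoc, mul_assoc, ← mul_assoc (s x), ← ω.central, mul_assoc]
    rw [ω.ι_mul, ω.ι_mul, ω.ι_mul] at e2
    have e3 := Multiplicative.ofAdd.injective (ω.ι_injective e2)
    simp only [d1]
    linear_combination -e3

end CentralExtension

section BPairing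

variable {m : ℕ} (Ω : Set (CentralExtension.{u} m))

/-- `T(G)`: the intersection of the kernels of all continuous homomorphisms `G → U_ω`, `ω ∈ Ω`. -/
def T (G : Type v) [Group G] [TopologicalSpace G] : Subgroup G :=
  ⨅ ω ∈ Ω, ⨅ ρ : G →ₜ* ω.U, (ρ : G →* ω.U).ker

/-- `T̄(G)`: the intersection of the kernels of all continuous homomorphisms `G → Ū_ω`, `ω ∈ Ω`. -/
def Tbar (G : Type v) [Group G] [TopologicalSpace G] : Subgroup G :=
  ⨅ ω ∈ Ω, ⨅ ρ : G →ₜ* ω.Ubar, (ρ : G →* ω.Ubar).ker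

instance T_normal (G : Type v) [Group G] [TopologicalSpace G] : (T Ω G).Normal := by
  refine ⟨fun n hn g => ?_⟩
  simp only [T, Subgroup.mem_iInf] at hn ⊢
  exact fun ω hω ρ => (MonoidHom.normal_ker _).conj_mem n (hn ω hω ρ) g

variable {G : Type v} [Group G] [TopologicalSpace G]

/-- If `ℤ/m` embeds in some `Ū_ω`, then every continuous homomorphism `G → ℤ/m` is trivial on
`T̄(G)`. -/
theorem H1_val_eq_zero (hΩ : Ω.Nonempty) (hII : ∀ ω ∈ Ω, ω.CondII) {N : Subgroup G}
    (hN : N ≤ Tbar Ω G) (φ : H1 m G) (g : G) (hg : g ∈ N) : φ.val g = 0 := by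
  obtain ⟨ω, hω⟩ := hΩ
  obtain ⟨j, hj⟩ := hII ω hω
  let ρ : G →ₜ* ω.Ubar :=
    { toMonoidHom := j.comp (AddMonoidHom.toMultiplicativeRight (φ : Additive G →+ ZMod m))
      continuous_toFun :=
        (continuous_of_discreteTopology (f := fun z : ZMod m =>
          j (Multiplicative.ofAdd z))).comp φ.val_continuous }
  have h1 := hN hg
  simp only [Tbar, Subgroup.mem_iInf] at h1
  have h2 : j (Multiplicative.ofAdd (φ.val g)) = 1 := h1 ω hω ρ
  rw [← map_one j] at h2
  exact Multiplicative.ofAdd.injective (hj h2)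

/-- The bilinear map `⟨·,·⟩^A : N₂ / N₁ N₂^m [G, N₂] × A_G(N₁, N₂) → ℤ/m` induced by the
substitution pairing through the transgression isomorphism; thus
`⟨σ, trg ψ⟩^A = ψ(σ)`. -/
noncomputable def pairingA [IsTopologicalGroup G] [CompactSpace G] [T2Space G]
    [TotallyDisconnectedSpace G] (hΩ : Ω.Nonempty) (hII : ∀ ω ∈ Ω, ω.CondII)
    {N₁ N₂ : Subgroup G} [N₁.Normal] [N₂.Normal] (h : N₁ ≤ N₂) (hcl : IsClosed (N₂ : Set G))
    (hT : N₂ ≤ Tbar Ω G) :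
    Pairing m (N₂ ⧸ (powComm m N₁ N₂).subgroupOf N₂) (AG m h) :=
  (substPairing m h hcl).comp
    (trgEquiv h (H1_val_eq_zero Ω hΩ hII hT)).symm.toAddMonoidHom

theorem pairingA_trg [IsTopologicalGroup G] [CompactSpace G] [T2Space G]
    [TotallyDisconnectedSpace G] (hΩ : Ω.Nonempty) (hII : ∀ ω ∈ Ω, ω.CondII)
    {N₁ N₂ : Subgroup G} [N₁.Normal] [N₂.Normal] (h : N₁ ≤ N₂) (hcl : IsClosed (N₂ : Set G))
    (hT : N₂ ≤ Tbar Ω G) (σ : N₂) (ψ : resKer m h) :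
    (pairingA Ω hΩ hII h hcl hT).val (QuotientGroup.mk σ) ⟨trg m N₂ ψ.1, trg_mem_AG h ψ⟩ =
      ψ.1.1.val σ := by
  have : (trgEquiv h (H1_val_eq_zero Ω hΩ hII hT)).symm ⟨trg m N₂ ψ.1, trg_mem_AG h ψ⟩ = ψ :=
    (trgEquiv h (H1_val_eq_zero Ω hΩ hII hT)).symm_apply_apply ψ
  change (substPairing m h hcl).val _
    ((trgEquiv h (H1_val_eq_zero Ω hΩ hII hT)).symm _) = _
  rw [this, substPairing_val]

/-- A continuous homomorphism `ρ̄ : G/N → Ū_ω` is liftable (with respect to `π : G → G/N`) if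
`λ_ω ∘ ρ = ρ̄ ∘ π` for some continuous homomorphism `ρ : G → U_ω`. -/
def IsLiftable (ω : CentralExtension.{u} m) (N : Subgroup G) [N.Normal]
    (ρbar : (G ⧸ N) →ₜ* ω.Ubar) : Prop :=
  ∃ ρ : G →ₜ* ω.U, ∀ g : G, ω.lam (ρ g) = ρbar (g : G ⧸ N)

/-- `B_G(N₁, N₂)`: the subgroup of `H²(G/N₂)` generated by the pullbacks `ρ̄^*(α_ω)` that lie in
`A_G(N₁, N₂)`, with `ω ∈ Ω` and `ρ̄ : G/N₂ → Ū_ω` liftable with respect to `G → G/N₂`. -/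
def BG [NeZero m] {N₁ N₂ : Subgroup G} [N₁.Normal] [N₂.Normal] (h : N₁ ≤ N₂) :
    AddSubgroup (H2 m (G ⧸ N₂)) :=
  AddSubgroup.closure {a | a ∈ AG m h ∧ ∃ ω ∈ Ω, ∃ ρbar : (G ⧸ N₂) →ₜ* ω.Ubar,
    IsLiftable ω N₂ ρbar ∧ a = H2.map m ρbar ω.cls}

theorem BG_le_AG [NeZero m] {N₁ N₂ : Subgroup G} [N₁.Normal] [N₂.Normal] (h : N₁ ≤ N₂) :
    BG Ω h ≤ AG m h :=
  (AddSubgroup.closure_le _).2 fun _ ha => ha.1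

/-- The subgroup `π₁⁻¹[T(G/N₁)]` of `G`. -/
def preT (N₁ : Subgroup G) [N₁.Normal] : Subgroup G :=
  (T Ω (G ⧸ N₁)).comap (QuotientGroup.mk' N₁)

instance preT_normal (N₁ : Subgroup G) [N₁.Normal] : (preT Ω N₁).Normal :=
  Subgroup.normal_comap _

end BPairing

end KernelGen

open KernelGen

/-! Let `ρ : G → U_ω` lift `ρ̄ : G/N₂ → Ū_ω`. Then `ρ` maps `N₂` into the central kernel `ℤ/m`, and
`ψ = -ρ|N₂` is an invariant character whose transgression is `ρ̄^*(α_ω)`. Because `N₂ ≤ T̄(G)` and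
`ℤ/m` embeds in some `Ū_ω`, characters of `G` die on `N₂`, so transgression is injective and `ψ` is
determined by the class. Hence `ρ̄^*(α_ω)` lies in `A_G(N₁, N₂)` exactly when `ψ` is trivial on
`N₁`, that is, when `ρ` factors through `G/N₁`.

Conversely, for any `ρ₁ : G/N₁ → U_ω` the composite `λ_ω ∘ ρ₁ ∘ π₁` kills `N₂`, again because `N₂ ≤
T̄(G)`, so it descends to a liftable `ρ̄`. The generators of `B_G(N₁, N₂)` therefore correspond to
the restrictions to `N₂` of all homomorphisms `G/N₁ → U_ω`, and the annihilator of `B_G(N₁, N₂)` in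
`N₂` is `N₂ ∩ π₁⁻¹[T(G/N₁)]`. This makes the restriction of `⟨·,·⟩^A` descend and be non-degenerate
on the left (`BG.char_val_eq_zero`, `BG.mem_preT_of_char_val_eq_zero`). On the right, non-degeneracy
is the injectivity of `b ↦ ψ`.

For `m = p` prime, perfectness is a general fact about non-degenerate pairings of a compact group
with values in `ℤ/p`: linear algebra over `𝔽_p` on finite subsets, followed by compactness
(`Pairing.Nondegenerate.perfect`). -/

namespace KernelGen

/-! ### Duality over `𝔽_p`: non-degenerate implies perfect -/

section Duality

variable {p : ℕ} {A : Type v} {B : Type w} [Group A] [TopologicalSpace A] [AddCommGroup B]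

theorem nsmul_continuousAddMonoidHom_eq_zero (χ : Additive A →ₜ+ ZMod p) : p • χ = 0 := by
  refine DFunLike.ext _ _ fun a => ?_
  let ev : (Additive A →ₜ+ ZMod p) →+ ZMod p :=
    { toFun := fun χ => χ a
      map_zero' := rfl
      map_add' := fun _ _ => rfl }
  exact (map_nsmul ev p χ).trans (by simp)

/-- Characters of `B` are evaluations at points of `A` on finite subsets of `B`. -/
theorem Pairing.exists_val_eq_of_finset [Fact p.Prime] [Module (ZMod p) B] (P : Pairing p A B)
    (hP : Function.Injective P.right) (f : B →+ ZMod p) (F : Finset B) :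
    ∃ a : A, ∀ b ∈ F, P.val a b = f b := by
  let W : Submodule (ZMod p) B := Submodule.span (ZMod p) (F : Set B)
  have : FiniteDimensional (ZMod p) W := FiniteDimensional.span_finset (ZMod p) F
  let ev : Additive A →+ Module.Dual (ZMod p) W :=
    { toFun := fun a => ((P.left a).comp W.subtype.toAddMonoidHom).toZModLinearMap p
      map_zero' := by rw [map_zero]; rfl
      map_add' := fun a a' => by rw [map_add]; rfl }
  -- The evaluations at points of `A` form a subgroup of the dual of `W`, hence an `𝔽_p`-subspace;
  -- finite dimension allows it to be identified by its annihilator in `W`.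
  let M : Submodule (ZMod p) (Module.Dual (ZMod p) W) := AddSubgroup.toZModSubmodule p ev.range
  have hM : M = ⊤ := by
    have h0 : M.dualCoannihilator = ⊥ := by
      rw [eq_bot_iff]
      -- An element of `W` killed by every point of `A` is zero because `B` embeds into the
      -- characters of `A`.
      intro b hb
      rw [Submodule.mem_dualCoannihilator] at hb
      rw [Submodule.mem_bot]
      apply Subtype.ext
      apply hP
      rw [ZeroMemClass.coe_zero, map_zero]
      exact DFunLike.ext _ _ fun a => hb (ev a) ⟨a, rfl⟩
    rw [← Subspace.dualCoannihilator_dualAnnihilator_eq (W := M), h0,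
      Submodule.dualAnnihilator_bot]
  obtain ⟨a, ha⟩ : (f.comp W.subtype.toAddMonoidHom).toZModLinearMap p ∈ M := by
    rw [hM]; trivial
  exact ⟨a.toMul, fun b hb =>
    LinearMap.congr_fun ha (⟨b, Submodule.subset_span hb⟩ : W)⟩

/-- Over a prime field every subgroup is a subspace, so linear functionals separate it from outside
points. This is one of the places where primality enters. -/
theorem exists_addMonoidHom_ne_zero_of_notMem [Fact p.Prime] [Module (ZMod p) B]
    (R : AddSubgroup B) {x : B} (hx : x ∉ R) :
    ∃ f : B →+ ZMod p, f x ≠ 0 ∧ ∀ r ∈ R, f r = 0 := by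
  obtain ⟨f, hfx, hfR⟩ := Submodule.exists_le_ker_of_notMem
    (p := AddSubgroup.toZModSubmodule p R) (v := x) hx
  exact ⟨f.toAddMonoidHom, hfx, fun r hr => hfR hr⟩

theorem Pairing.val_continuous (P : Pairing p A B) (b : B) : Continuous fun a => P.val a b :=
  (P b).continuous_toFun

/-- The conditions `⟨a, b⟩ = f(b)`, one for each `b`, define closed subsets of `A`. Any finitely
many have a common point by linear algebra, so compactness gives a point common to all. -/
theorem Pairing.left_surjective [CompactSpace A] (hp : p.Prime) (P : Pairing p A B)
    (hP : Function.Injective P.right) : Function.Surjective P.left := by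
  intro f
  have : Fact p.Prime := ⟨hp⟩
  -- `B` is killed by `p` since it embeds into a group of `ℤ/p`-valued characters.
  let _ : Module (ZMod p) B := AddCommGroup.zmodModule (n := p) fun b => hP (by
    rw [map_nsmul, map_zero, nsmul_continuousAddMonoidHom_eq_zero])
  have hne : (⋂ b : B, {a : A | P.val a b = f b}).Nonempty := by
    by_contra hempty
    rw [Set.not_nonempty_iff_eq_empty] at hempty
    obtain ⟨F, hF⟩ := isCompact_univ.elim_finite_subfamily_closed
      (fun b : B => {a : A | P.val a b = f b})
      (fun b => isClosed_eq (P.val_continuous b) continuous_const)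
      (by rw [hempty, Set.inter_empty])
    obtain ⟨a, ha⟩ := P.exists_val_eq_of_finset hP f F
    have : a ∈ (Set.univ ∩ ⋂ b ∈ F, {a : A | P.val a b = f b}) :=
      ⟨trivial, Set.mem_iInter₂.2 ha⟩
    rw [hF] at this
    exact this
  obtain ⟨a, ha⟩ := hne
  exact ⟨Additive.ofMul a, AddMonoidHom.ext fun b => Set.mem_iInter.1 ha b⟩

/-- A non-degenerate pairing of a compact group with values in `ℤ/p`, `p` prime, is perfect. -/
theorem Pairing.Nondegenerate.perfect [CompactSpace A] (hp : p.Prime) {P : Pairing p A B}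
    (hP : P.Nondegenerate) : P.Perfect := by
  refine ⟨⟨hP.1, P.left_surjective hp hP.2⟩, hP.2, ?_⟩
  have : Fact p.Prime := ⟨hp⟩
  let _ : Module (ZMod p) (Additive A →ₜ+ ZMod p) :=
    AddCommGroup.zmodModule nsmul_continuousAddMonoidHom_eq_zero
  intro χ
  by_contra hχ
  -- Suppose `χ` does not come from `B`, and separate it from the image of `B` by a functional `f`
  -- on all characters of `A`.
  obtain ⟨f, hfχ, hfR⟩ := exists_addMonoidHom_ne_zero_of_notMem (p := p) P.right.range hχ
  -- Surjectivity for the tautological pairing of `A` with all its characters turns `f` into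
  -- evaluation at some `a`. This `a` pairs trivially with `B`, so it is trivial by left
  -- non-degeneracy, which contradicts `f(χ) ≠ 0`.
  let Q : Pairing p A (Additive A →ₜ+ ZMod p) := AddMonoidHom.id _
  obtain ⟨a, ha⟩ := Q.left_surjective hp Function.injective_id f
  have ha0 : a = 0 := by
    apply hP.1
    rw [map_zero]
    ext b
    exact (DFunLike.congr_fun ha (P b)).trans (hfR _ ⟨b, rfl⟩)
  apply hfχ
  have h2 := DFunLike.congr_fun ha χ
  rw [ha0, map_zero] at h2
  exact h2.symm

end Duality

/-! ### Lifts to `U_ω` and transgression -/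

section Lifting

variable {m : ℕ} {G : Type v} [Group G] [TopologicalSpace G]

theorem H2.map_mk {K : Type w} [Group K] [TopologicalSpace K] (f : G →ₜ* K) (c : Z2 m K) :
    H2.map m f (H2.mk c) = H2.mk (Z2.map m f c) := rfl

/-- The restriction to `N` of a lift of `ρ̄ : G/N → Ū` transgresses, up to sign, to the pullback
of the classifying element. -/
theorem exists_trg_eq_map_cls [NeZero m] [IsTopologicalGroup G] [CompactSpace G] [T2Space G]
    [TotallyDisconnectedSpace G] (ω : CentralExtension.{u} m) (N : Subgroup G) [hN : N.Normal]
    (ρ : G →ₜ* ω.U) (ρbar : (G ⧸ N) →ₜ* ω.Ubar) (hρ : ∀ g : G, ω.lam (ρ g) = ρbar (g : G ⧸ N)) :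
    ∃ ψ : invH1 m N, (∀ n : N, ω.ι (Multiplicative.ofAdd (ψ.1.val n)) = (ρ n)⁻¹) ∧
      trg m N ψ = H2.map m ρbar ω.cls := by
  obtain ⟨c, s, hsc, hs, hf⟩ := ω.exists_isFactorSet
  have hιinj : ∀ a b : ZMod m, ω.ι (Multiplicative.ofAdd a) = ω.ι (Multiplicative.ofAdd b) →
      a = b := fun a b hab => Multiplicative.ofAdd.injective (ω.ι_injective hab)
  -- The cochain `y` measures the discrepancy between the section along `ρ̄` and the homomorphism
  -- `ρ`. As `ρ` is multiplicative, the coboundary of `y` is the pulled-back factor set.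
  have h : ∀ g : G, ∃ z : ZMod m,
      ω.ι (Multiplicative.ofAdd z) = s (ρbar (g : G ⧸ N)) * (ρ g)⁻¹ := by
    intro g
    obtain ⟨z, hz⟩ := (ω.exact (s (ρbar (g : G ⧸ N)) * (ρ g)⁻¹)).1 (by simp [hs, hρ])
    exact ⟨z.toAdd, hz⟩
  choose y hy using h
  have hy' : ∀ g : G, s (ρbar (g : G ⧸ N)) = ω.ι (Multiplicative.ofAdd (y g)) * ρ g := by
    intro g; rw [hy]; simp
  have hyc : Continuous y := by
    have h1 : Continuous (fun g => ω.ι (Multiplicative.ofAdd (y g))) := by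
      simp only [hy]
      exact (hsc.comp (ρbar.continuous_toFun.comp QuotientGroup.continuous_mk)).mul
        ρ.continuous_toFun.inv
    exact ω.isClosedEmbedding_ι.isEmbedding.continuous_iff.2 h1
  have hcy : ∀ a b : G, c.1 (ρbar (a : G ⧸ N), ρbar (b : G ⧸ N)) = d1 y (a, b) := by
    intro a b
    have e := hf (ρbar (a : G ⧸ N)) (ρbar (b : G ⧸ N))
    rw [← map_mul, ← QuotientGroup.mk_mul, hy', hy', hy', map_mul, mul_assoc, ← mul_assoc (ρ a),
      ← ω.central, mul_assoc, ← mul_assoc, ω.ι_mul, ← mul_assoc (ω.ι _) (ω.ι _), ω.ι_mul] at e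
    have e' := hιinj _ _ (mul_right_cancel e)
    simp only [d1]
    linear_combination -e'
  -- The section need not satisfy `s(1) = 1`, so `y` has to be shifted by the constant `k` before
  -- its restriction to `N` is a character.
  let k : ZMod m := y 1
  have hk : s 1 = ω.ι (Multiplicative.ofAdd k) := by
    have := hy' 1
    rwa [QuotientGroup.mk_one, map_one, map_one, mul_one] at this
  have hval : ∀ n : N, ω.ι (Multiplicative.ofAdd (y n - k)) = (ρ n)⁻¹ := by
    intro n
    have h1 := hy n
    rw [(QuotientGroup.eq_one_iff (n : G)).2 n.2, map_one, hk] at h1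
    rw [sub_eq_neg_add, ← ω.ι_mul, h1, ← mul_assoc, ω.ι_mul, neg_add_cancel, ofAdd_zero, map_one,
      one_mul]
  -- Centrality of `ρ(N)` gives both the additivity of `ψ`, where inversion reverses products, and
  -- its invariance under conjugation.
  have hcomm : ∀ (n : N) (u : ω.U), (ρ n)⁻¹ * u = u * (ρ n)⁻¹ := by
    intro n u
    rw [← hval, ω.central]
  let ψ : H1 m N :=
    { toAddMonoidHom := AddMonoidHom.mk' (fun n : Additive N => y (n.toMul : N) - k) (by
        intro a b
        apply hιinj
        rw [← ω.ι_mul, hval, hval, hval, toMul_add, Subgroup.coe_mul, map_mul, mul_inv_rev, hcomm])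
      continuous_toFun := (hyc.comp continuous_subtype_val).sub continuous_const }
  have hψ : ∀ n : N, ψ.val n = y n - k := fun n => rfl
  have hinv : ψ ∈ invH1 m N := by
    intro g n
    apply hιinj
    rw [hψ, hψ, hval, hval, map_mul, map_mul, map_inv, mul_inv_rev, mul_inv_rev, inv_inv,
      hcomm, mul_inv_cancel_left]
  refine ⟨⟨ψ, hinv⟩, hval, ?_⟩
  -- Shifting `y` by `k` changes its coboundary by that of a constant cochain, so the cohomology
  -- class is unaffected.
  let c' : Z2 m (G ⧸ N) := Z2.map m ρbar c - ⟨d1 (fun _ => k), d1_mem_Z2 continuous_const⟩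
  rw [ω.cls_eq ⟨s, hsc, hs, hf⟩, H2.map_mk, trg_eq N ⟨ψ, hinv⟩ (c := c')
    ⟨fun g => y g - k, hyc.sub continuous_const, fun n => rfl, fun a b => ?_⟩, H2.mk_eq_iff]
  · refine ⟨fun _ => k, continuous_const, fun q => ?_⟩
    change _ = (Z2.map m ρbar c).1 q - d1 (fun _ : G ⧸ N => k) q + d1 (fun _ : G ⧸ N => k) q
    ring
  · change c.1 (ρbar (a : G ⧸ N), ρbar (b : G ⧸ N)) - d1 (fun _ : G ⧸ N => k) (a, b) = _
    rw [hcy]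
    simp only [d1]
    ring

/-- A continuous homomorphism on `G` that is trivial on `N` descends to `G/N`. -/
def descend {K : Type w} [Group K] [TopologicalSpace K] (N : Subgroup G) [N.Normal]
    (f : G →ₜ* K) (hf : ∀ n ∈ N, f n = 1) : (G ⧸ N) →ₜ* K where
  toMonoidHom := QuotientGroup.lift N (f : G →* K) hf
  continuous_toFun := (QuotientGroup.isQuotientMap_mk (N := N)).continuous_iff.2 f.continuous_toFun

/-- A character of `G` that is trivial on `N` descends to `G/N`. -/
def H1.descend (φ : H1 m G) (N : Subgroup G) [N.Normal] (hφ : ∀ n ∈ N, φ.val n = 0) :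
    H1 m (G ⧸ N) where
  toFun x := (QuotientGroup.lift N
    (AddMonoidHom.toMultiplicativeRight (φ : Additive G →+ ZMod m)) hφ x.toMul).toAdd
  map_zero' := by simp
  map_add' a b := by simp
  continuous_toFun :=
    (QuotientGroup.isQuotientMap_mk (N := N)).continuous_iff.2 φ.continuous_toFun

/-- The projection `G → G/N` as a continuous homomorphism. -/
def projection (N : Subgroup G) [N.Normal] : G →ₜ* (G ⧸ N) where
  toMonoidHom := QuotientGroup.mk' N
  continuous_toFun := QuotientGroup.continuous_mk

theorem mem_preT (Ω : Set (CentralExtension.{u} m)) (N : Subgroup G) [N.Normal] (g : G) :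
    g ∈ preT Ω N ↔ ∀ ω ∈ Ω, ∀ ρ : (G ⧸ N) →ₜ* ω.U, ρ (g : G ⧸ N) = 1 := by
  simp only [preT, T, Subgroup.mem_comap, Subgroup.mem_iInf]
  rfl

theorem eq_one_of_mem_Tbar {Ω : Set (CentralExtension.{u} m)} {ω : CentralExtension.{u} m}
    (hω : ω ∈ Ω) {g : G} (hg : g ∈ Tbar Ω G) (ρ : G →ₜ* ω.Ubar) : ρ g = 1 := by
  simp only [Tbar, Subgroup.mem_iInf] at hg
  exact hg ω hω ρ

end Lifting

/-! ### The annihilator of `B_G(N₁, N₂)` and the pairing `⟨·,·⟩^B` -/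

section BPairing

variable {m : ℕ} (Ω : Set (CentralExtension.{u} m)) {G : Type v} [Group G] [TopologicalSpace G]
  [IsTopologicalGroup G] [CompactSpace G] [T2Space G] [TotallyDisconnectedSpace G]

/-- For `N₁ = ⊥` the restriction condition is empty, so this is the injectivity half of
`trgA_bijective`. It lets characters of `N` be compared through their transgressions. -/
theorem trg_injective {N : Subgroup G} [N.Normal]
    (hH1 : ∀ (φ : H1 m G) (g : G), g ∈ N → φ.val g = 0) : Function.Injective (trg m N) := by
  intro ψ φ h
  have hmem : ∀ χ : invH1 m N, χ ∈ resKer m (bot_le : ⊥ ≤ N) := by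
    intro χ
    rw [mem_resKer]
    intro g hg
    obtain rfl := Subgroup.mem_bot.1 hg
    exact χ.1.val_one
  have := (trgA_bijective (bot_le : ⊥ ≤ N) hH1).1
    (a₁ := ⟨ψ, hmem ψ⟩) (a₂ := ⟨φ, hmem φ⟩) (Subtype.ext h)
  exact congrArg Subtype.val this

/-- The element of `Ker(H¹(N₂)^G → H¹(N₁))` whose transgression is a given element of
`B_G(N₁, N₂)`. -/
noncomputable def BG.char [NeZero m] (hΩ : Ω.Nonempty) (hII : ∀ ω ∈ Ω, ω.CondII)
    {N₁ N₂ : Subgroup G} [N₁.Normal] [N₂.Normal] (h : N₁ ≤ N₂) (hT : N₂ ≤ Tbar Ω G) :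
    BG Ω h →+ resKer m h :=
  (trgEquiv h (H1_val_eq_zero Ω hΩ hII hT)).symm.toAddMonoidHom.comp
    (AddSubgroup.inclusion (BG_le_AG Ω h))

variable {Ω}

theorem BG.char_injective [NeZero m] (hΩ : Ω.Nonempty) (hII : ∀ ω ∈ Ω, ω.CondII)
    {N₁ N₂ : Subgroup G} [N₁.Normal] [N₂.Normal] (h : N₁ ≤ N₂) (hT : N₂ ≤ Tbar Ω G) :
    Function.Injective (BG.char Ω hΩ hII h hT) :=
  (trgEquiv h (H1_val_eq_zero Ω hΩ hII hT)).symm.injective.comp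
    (AddSubgroup.inclusion_injective (BG_le_AG Ω h))

theorem BG.trg_char [NeZero m] (hΩ : Ω.Nonempty) (hII : ∀ ω ∈ Ω, ω.CondII)
    {N₁ N₂ : Subgroup G} [N₁.Normal] [N₂.Normal] (h : N₁ ≤ N₂) (hT : N₂ ≤ Tbar Ω G)
    (b : BG Ω h) : trg m N₂ (BG.char Ω hΩ hII h hT b).1 = b :=
  congrArg Subtype.val ((trgEquiv h (H1_val_eq_zero Ω hΩ hII hT)).apply_symm_apply
    (AddSubgroup.inclusion (BG_le_AG Ω h) b))

/-- The elements of `B_G(N₁, N₂)` vanish on `N₂ ∩ π₁⁻¹[T(G/N₁)]`. -/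
theorem BG.char_val_eq_zero [NeZero m] (hΩ : Ω.Nonempty) (hII : ∀ ω ∈ Ω, ω.CondII)
    {N₁ N₂ : Subgroup G} [N₁.Normal] [N₂.Normal] (h : N₁ ≤ N₂) (hT : N₂ ≤ Tbar Ω G)
    (n : N₂) (hn : (n : G) ∈ preT Ω N₁) (b : BG Ω h) :
    (BG.char Ω hΩ hII h hT b).1.1.val n = 0 := by
  have hH1 := H1_val_eq_zero Ω hΩ hII hT
  obtain ⟨b, hb⟩ := b
  -- Stated for some `ψ` with transgression `b`, the claim is stable under the group operations and
  -- need only be checked on generators; injectivity of `trg` recovers the chosen character.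
  suffices hex : ∃ ψ : resKer m h, trg m N₂ ψ.1 = b ∧ ψ.1.1.val n = 0 by
    obtain ⟨ψ, hψ, hψn⟩ := hex
    have e : (BG.char Ω hΩ hII h hT ⟨b, hb⟩).1 = ψ.1 :=
      trg_injective hH1 ((BG.trg_char hΩ hII h hT ⟨b, hb⟩).trans hψ.symm)
    rw [e, hψn]
  induction hb using AddSubgroup.closure_induction with
  | mem a ha =>
    obtain ⟨haA, ω, hω, ρbar, ⟨ρ, hρ⟩, rfl⟩ := ha
    obtain ⟨φ, hφ, hφt⟩ := exists_trg_eq_map_cls ω N₂ ρ ρbar hρ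
    obtain ⟨ψ, hψ⟩ := (trgA_bijective h hH1).2 ⟨_, haA⟩
    have hψt : trg m N₂ ψ.1 = H2.map m ρbar ω.cls := congrArg Subtype.val hψ
    -- The character coming from the lift `ρ` is thus the one supplied by membership in `A_G(N₁,
    -- N₂)`, so it vanishes on `N₁` and `ρ` factors through `G/N₁`.
    obtain rfl : ψ.1 = φ := trg_injective hH1 (hψt.trans hφt.symm)
    refine ⟨ψ, hψt, ?_⟩
    have hρ1 : ∀ g ∈ N₁, ρ g = 1 := by
      intro g hg
      have h1 := hφ ⟨g, h hg⟩
      rw [(mem_resKer h ψ.1).1 ψ.2 g hg, ofAdd_zero, map_one] at h1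
      exact inv_eq_one.1 h1.symm
    have h2 : ρ n = 1 := (mem_preT Ω N₁ n).1 hn ω hω (descend N₁ ρ hρ1)
    have h3 := hφ n
    rw [h2, inv_one, ← map_one ω.ι] at h3
    exact Multiplicative.ofAdd.injective (ω.ι_injective h3)
  | zero => exact ⟨0, map_zero _, rfl⟩
  | add x y _ _ hx hy =>
    obtain ⟨ψ, hψ, hψn⟩ := hx
    obtain ⟨φ, hφ, hφn⟩ := hy
    refine ⟨ψ + φ, ?_, ?_⟩
    · rw [← hψ, ← hφ]; exact map_add (trg m N₂) ψ.1 φ.1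
    · change ψ.1.1.val n + φ.1.1.val n = 0
      rw [hψn, hφn, add_zero]
  | neg x _ hx =>
    obtain ⟨ψ, hψ, hψn⟩ := hx
    refine ⟨-ψ, ?_, ?_⟩
    · rw [← hψ]; exact map_neg (trg m N₂) ψ.1
    · change -ψ.1.1.val n = 0
      rw [hψn, neg_zero]

/-- An element of `N₂` annihilated by `B_G(N₁, N₂)` lies in `π₁⁻¹[T(G/N₁)]`. -/
theorem BG.mem_preT_of_char_val_eq_zero [NeZero m] (hΩ : Ω.Nonempty) (hII : ∀ ω ∈ Ω, ω.CondII)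
    {N₁ N₂ : Subgroup G} [N₁.Normal] [N₂.Normal] (h : N₁ ≤ N₂) (hT : N₂ ≤ Tbar Ω G)
    (n : N₂) (hn : ∀ b : BG Ω h, (BG.char Ω hΩ hII h hT b).1.1.val n = 0) :
    (n : G) ∈ preT Ω N₁ := by
  have hH1 := H1_val_eq_zero Ω hΩ hII hT
  rw [mem_preT]
  intro ω hω ρ₁
  let ρ : G →ₜ* ω.U := ρ₁.comp (projection N₁)
  -- Here `N₂ ≤ T̄(G)` produces the liftable homomorphism on `G/N₂`, with `ρ` itself as its lift.
  have hρbar : ∀ x ∈ N₂, (ω.lam.comp ρ) x = 1 :=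
    fun x hx => eq_one_of_mem_Tbar hω (hT hx) _
  obtain ⟨ψ, hψ, hψt⟩ := exists_trg_eq_map_cls ω N₂ ρ (descend N₂ (ω.lam.comp ρ) hρbar)
    (fun g => rfl)
  have hres : ψ ∈ resKer m h := by
    rw [mem_resKer]
    intro g hg
    have h1 := hψ ⟨g, h hg⟩
    have h2 : ρ g = 1 := by
      change ρ₁ (g : G ⧸ N₁) = 1
      rw [(QuotientGroup.eq_one_iff g).2 hg, map_one]
    rw [h2, inv_one, ← map_one ω.ι] at h1
    exact Multiplicative.ofAdd.injective (ω.ι_injective h1)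
  have hB : trg m N₂ ψ ∈ BG Ω h :=
    AddSubgroup.subset_closure ⟨trg_mem_AG h ⟨ψ, hres⟩, ω, hω, _, ⟨ρ, fun g => rfl⟩, hψt⟩
  have e : (BG.char Ω hΩ hII h hT ⟨_, hB⟩).1 = ψ :=
    trg_injective hH1 (BG.trg_char hΩ hII h hT ⟨_, hB⟩)
  have h1 := hn ⟨_, hB⟩
  rw [e] at h1
  have h2 := hψ n
  rw [h1, ofAdd_zero, map_one] at h2
  exact inv_eq_one.1 h2.symm

/-- The pairing `⟨·,·⟩^B`. -/
noncomputable def pairingB [NeZero m] (hΩ : Ω.Nonempty) (hII : ∀ ω ∈ Ω, ω.CondII)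
    {N₁ N₂ : Subgroup G} [N₁.Normal] [N₂.Normal] (h : N₁ ≤ N₂) (hT : N₂ ≤ Tbar Ω G) :
    Pairing m (N₂ ⧸ (preT Ω N₁).subgroupOf N₂) (BG Ω h) where
  toFun b := (BG.char Ω hΩ hII h hT b).1.1.descend _
    fun n hn => BG.char_val_eq_zero hΩ hII h hT n hn b
  map_zero' := by
    refine DFunLike.ext _ _ fun x => ?_
    obtain ⟨n, rfl⟩ := QuotientGroup.mk_surjective (s := (preT Ω N₁).subgroupOf N₂) x
    change (BG.char Ω hΩ hII h hT 0).1.1.val n = 0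
    rw [map_zero]; rfl
  map_add' a b := by
    refine DFunLike.ext _ _ fun x => ?_
    obtain ⟨n, rfl⟩ := QuotientGroup.mk_surjective (s := (preT Ω N₁).subgroupOf N₂) x
    change (BG.char Ω hΩ hII h hT (a + b)).1.1.val n =
      (BG.char Ω hΩ hII h hT a).1.1.val n + (BG.char Ω hΩ hII h hT b).1.1.val n
    rw [map_add]; rfl

/-- On the left, what has been factored out is the whole annihilator of `B_G(N₁, N₂)`. On the right,
a class whose character vanishes on all of `N₂` is zero. -/
theorem pairingB_nondegenerate [NeZero m] (hΩ : Ω.Nonempty) (hII : ∀ ω ∈ Ω, ω.CondII)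
    {N₁ N₂ : Subgroup G} [N₁.Normal] [N₂.Normal] (h : N₁ ≤ N₂) (hT : N₂ ≤ Tbar Ω G) :
    (pairingB hΩ hII h hT).Nondegenerate := by
  constructor
  · rw [injective_iff_map_eq_zero]
    intro x hx
    obtain ⟨n, hn⟩ := QuotientGroup.mk_surjective x.toMul
    obtain rfl : x = Additive.ofMul (QuotientGroup.mk n) := by rw [hn]; rfl
    have h1 : (QuotientGroup.mk n : N₂ ⧸ (preT Ω N₁).subgroupOf N₂) = 1 :=
      (QuotientGroup.eq_one_iff n).2 (BG.mem_preT_of_char_val_eq_zero hΩ hII h hT n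
        fun b => DFunLike.congr_fun hx b)
    rw [h1]; rfl
  · intro b c hbc
    apply BG.char_injective hΩ hII h hT
    apply Subtype.ext
    apply Subtype.ext
    exact H1.ext' fun n => DFunLike.congr_fun hbc (Additive.ofMul (QuotientGroup.mk n))

end BPairing

end KernelGen

/-! ### The main theorem -/

theorem theorem6p1 (m : ℕ) [NeZero m] (hm : 2 ≤ m)
    (Ω : Set (CentralExtension.{u} m)) (hΩ : Ω.Nonempty)
    (hI : ∀ ω ∈ Ω, ω.CondI) (hII : ∀ ω ∈ Ω, ω.CondII)
    (G : Type v) [Group G] [TopologicalSpace G] [IsTopologicalGroup G]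
    [CompactSpace G] [T2Space G] [TotallyDisconnectedSpace G]
    (N₁ N₂ : Subgroup G) [N₁.Normal] [N₂.Normal]
    (hN₁ : IsClosed (N₁ : Set G)) (hN₂ : IsClosed (N₂ : Set G))
    (h12 : N₁ ≤ N₂) (hT : N₂ ≤ Tbar Ω G) :
    ∃ (hle : (powComm m N₁ N₂).subgroupOf N₂ ≤ (preT Ω N₁).subgroupOf N₂)
      (P : Pairing m (N₂ ⧸ (preT Ω N₁).subgroupOf N₂) (BG Ω h12)),
      P.Nondegenerate ∧
      (∀ (x : N₂ ⧸ (powComm m N₁ N₂).subgroupOf N₂) (b : BG Ω h12),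
        P.val (QuotientGroup.map _ _ (MonoidHom.id N₂) hle x) b =
          (pairingA Ω hΩ hII h12 hN₂ hT).val x (AddSubgroup.inclusion (BG_le_AG Ω h12) b)) ∧
      (m.Prime → P.Perfect) := by
  -- Invariant `ℤ/m`-valued characters trivial on `N₁` kill `N₁ N₂^m [G, N₂]`, so this subgroup lies
  -- in the annihilator of `B_G(N₁, N₂)`.
  have hle : (powComm m N₁ N₂).subgroupOf N₂ ≤ (preT Ω N₁).subgroupOf N₂ := fun n hn =>
    BG.mem_preT_of_char_val_eq_zero hΩ hII h12 hT n fun b =>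
      resKer_vanish h12 hN₂ (BG.char Ω hΩ hII h12 hT b) n hn
  have hnd := pairingB_nondegenerate hΩ hII h12 hT
  -- Compactness passes to the quotient of `N₂`, as the duality argument requires.
  have : CompactSpace N₂ := isCompact_iff_compactSpace.1 hN₂.isCompact
  refine ⟨hle, pairingB hΩ hII h12 hT, hnd, fun x b => ?_, fun hp => hnd.perfect hp⟩
  obtain ⟨n, rfl⟩ := QuotientGroup.mk_surjective x
  -- Both pairings evaluate at `n` the same inverse transgression of `b`.
  rfl
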